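/- Let $K$ be a field, $n$ a natural number, and let $X$ be a sparse $2\times n$ matrix over $K$, i.e. a matrix each of whose entries is either zero or an indeterminate, the nonzero entries being pairwise distinct. Let $R=K[X]$ be the polynomial ring over $K$ in the indeterminates appearing in $X$, and let $I\subseteq R$ be the ideal generated by the $2\times 2$ minors of $X$. Let $\tau$ be a diagonal term order on $R$: after some permutation of the rows and of the columns of $X$, which does not change $I$, the leading term with respect to $\tau$ of each $2\times 2$ minor is the product of the two entries on its diagonal (with the convention that the leading term of $0$ is $0$). For an ideal $J\subseteq R$ let $\mathrm{in}_\tau(J)$ be the ideal generated by the leading terms of all elements of $J$. Then $$\mathrm{in}_\tau(I^2)=(\mathrm{in}_\tau(I))^2 .$$ -/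

import Mathlib

namespace SparseDet

noncomputable section

/-- A sparse `2 × n` matrix with entries in `K[x_v : v ∈ ι]`: every entry is zero or an
indeterminate, and the nonzero entries are pairwise distinct. -/
structure IsSparse {K ι : Type*} [Field K] {n : ℕ}
    (X : Matrix (Fin 2) (Fin n) (MvPolynomial ι K)) : Prop where
  zero_or_var : ∀ a j, X a j = 0 ∨ ∃ v, X a j = MvPolynomial.X v
  distinct : ∀ a j b k, X a j ≠ 0 → X a j = X b k → a = b ∧ j = k

/-- The `2 × 2` minor of `X` on the columns `i` and `j`. -/
def minor {R : Type*} [CommRing R] {n : ℕ} (X : Matrix (Fin 2) (Fin n) R) (i j : Fin n) : R :=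
  (X.submatrix id ![i, j]).det

/-- The ideal of `2 × 2` minors of `X`. -/
def minorsIdeal {R : Type*} [CommRing R] {n : ℕ} (X : Matrix (Fin 2) (Fin n) R) : Ideal R :=
  Ideal.span {f | ∃ i j : Fin n, i < j ∧ f = minor X i j}

/-- The term order `τ` is diagonal for `X`: the leading term of each `2 × 2` minor is the product
of the two entries on its diagonal (the leading term of `0` being `0`). -/
def IsDiagonalOrder {K ι : Type*} [Field K] {n : ℕ} (τ : MonomialOrder ι)
    (X : Matrix (Fin 2) (Fin n) (MvPolynomial ι K)) : Prop :=
  ∀ i j : Fin n, i < j → τ.leadingTerm (minor X i j) = X 0 i * X 1 j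

/-- The initial ideal of `I`, generated by the leading terms of all elements of `I`. -/
def initialIdeal {K ι : Type*} [Field K] (τ : MonomialOrder ι)
    (I : Ideal (MvPolynomial ι K)) : Ideal (MvPolynomial ι K) :=
  Ideal.span (τ.leadingTerm '' (I : Set (MvPolynomial ι K)))

end

end SparseDet

/-!
Being diagonal constrains the zeros of `X`: for `i < j`, a nonzero antidiagonal product
`x_j y_i` forces the diagonal product `x_i y_j` to be nonzero and larger
(`IsDiagonalOrder.antidiagonal_lt`). Hence the identities used for a matrix of indeterminates
remain valid for a sparse matrix, with the same comparison of leading monomials: a term with a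
zero entry just disappears.

The inclusion of `in(I) ^ 2` in `in(I ^ 2)` is multiplicativity of leading terms. For the converse,
let `M_ij` be the minors. By a form of Buchberger's criterion (`exists_degree_eq_of_mem_span`) it
is enough that two monomial multiples of products `M_ij M_kl` and `M_pq M_rs` with the same leading
monomial `x ^ w` differ by a combination of such multiples with smaller leading monomials; then
every leading term of `I ^ 2` is a multiple of a product of two leading terms of minors. Call two
such multiples congruent.

* For multiples of single minors, this congruence follows from explicit syzygies, such as
  `y_l M_ij - y_j M_il = -y_i M_jl` (`IsDiagonalOrder.sub_mem_of_minors`). Multiplying by a minor,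
  multiples of products of two minors with a common factor are congruent
  (`IsDiagonalOrder.sub_mem_of_common_factor`).
* If a leading monomial `x_p y_q` of one product, times that of a factor of the other product,
  divides `x ^ w`, the two products are joined by a third one having a factor in common with each
  (`IsDiagonalOrder.sub_mem_of_le`).
* If none of the four such exchanges is possible, each factor of one product shares with each
  factor of the other an entry that cannot be used twice. This forces the two products to be
  `M_ij M_kl` and `M_il M_kj`, and their difference is `M_ik M_jl` by the Plücker relation, with a
  smaller leading monomial (`IsDiagonalOrder.sub_mem_of_crossing`).
-/

namespace SparseDet

open MvPolynomial
open scoped MonomialOrder Pointwise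

noncomputable section

/-! ### A leading term criterion -/

section Criterion

variable {K ι : Type*} [Field K] {τ : MonomialOrder ι}

/-- The `K`-span of the multiples `x ^ c * g` of elements `g` of `G` by monomials for which the
exponent `c + deg g` lies in the set `S`. The order synonym `τ.syn` is used so that `S` can be an
interval for `τ`. -/
def multiplesSpan (τ : MonomialOrder ι) (G : Set (MvPolynomial ι K)) (S : Set τ.syn) :
    Submodule K (MvPolynomial ι K) :=
  Submodule.span K {h | ∃ c, ∃ g ∈ G, τ.toSyn (c + τ.degree g) ∈ S ∧ h = monomial c 1 * g}

lemma multiplesSpan_mono {G : Set (MvPolynomial ι K)} {S T : Set τ.syn} (h : S ⊆ T) :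
    multiplesSpan τ G S ≤ multiplesSpan τ G T := by
  refine Submodule.span_mono ?_
  rintro _ ⟨c, g, hg, hc, rfl⟩
  exact ⟨c, g, hg, h hc, rfl⟩

lemma mul_mem_multiplesSpan {G : Set (MvPolynomial ι K)} {S : Set τ.syn}
    {p g : MvPolynomial ι K} (hg : g ∈ G)
    (h : ∀ c ∈ p.support, τ.toSyn (c + τ.degree g) ∈ S) :
    p * g ∈ multiplesSpan τ G S := by
  rw [p.as_sum, Finset.sum_mul]
  refine Submodule.sum_mem _ fun c hc => ?_
  have : monomial c (p.coeff c) * g = p.coeff c • (monomial c 1 * g) := by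
    rw [← smul_mul_assoc, smul_monomial, smul_eq_mul, mul_one]
  rw [this]
  exact Submodule.smul_mem _ _ (Submodule.subset_span ⟨c, g, hg, h c hc, rfl⟩)

lemma mul_mem_multiplesSpan_Iio {G : Set (MvPolynomial ι K)} {w : ι →₀ ℕ}
    {p g : MvPolynomial ι K} (hg : g ∈ G) (h : p ≠ 0 → τ.degree p + τ.degree g ≺[τ] w) :
    p * g ∈ multiplesSpan τ G (Set.Iio (τ.toSyn w)) := by
  refine mul_mem_multiplesSpan hg fun c hc => ?_
  have hp : p ≠ 0 := by
    rintro rfl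
    simp at hc
  refine lt_of_le_of_lt ?_ (h hp)
  rw [map_add, map_add]
  exact add_le_add_left (τ.le_degree hc) _

lemma mem_multiplesSpan_univ (G : Set (MvPolynomial ι K)) {f : MvPolynomial ι K}
    (hf : f ∈ Ideal.span G) : f ∈ multiplesSpan τ G Set.univ := by
  obtain ⟨c, hc, rfl⟩ := Submodule.mem_span_set.1 hf
  exact Submodule.sum_mem _ fun g hg =>
    mul_mem_multiplesSpan (hc hg) fun _ _ => Set.mem_univ _

/-- An element of the span involves only finitely many multiples, so it lies in the part of the
span below one exponent of `S`. -/
lemma exists_mem_multiplesSpan_Iic {G : Set (MvPolynomial ι K)} {S : Set τ.syn}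
    {f : MvPolynomial ι K} (hf : f ∈ multiplesSpan τ G S) (hf0 : f ≠ 0) :
    ∃ w ∈ S, f ∈ multiplesSpan τ G (Set.Iic w) := by
  suffices h : f = 0 ∨ ∃ w ∈ S, f ∈ multiplesSpan τ G (Set.Iic w) from h.resolve_left hf0
  clear hf0
  induction hf using Submodule.span_induction with
  | mem h hh =>
    obtain ⟨c, g, hg, hc, rfl⟩ := hh
    exact Or.inr ⟨_, hc, Submodule.subset_span ⟨c, g, hg, le_rfl, rfl⟩⟩
  | zero => exact Or.inl rfl
  | add f g _ _ hf hg =>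
    rcases hf with rfl | ⟨v, hv, hf⟩
    · simpa using hg
    rcases hg with rfl | ⟨w, hw, hg⟩
    · exact Or.inr ⟨v, hv, by simpa using hf⟩
    refine Or.inr ⟨max v w, ?_, add_mem (multiplesSpan_mono ?_ hf) (multiplesSpan_mono ?_ hg)⟩
    · rcases max_choice v w with h | h <;> rw [h] <;> assumption
    · exact Set.Iic_subset_Iic.2 (le_max_left _ _)
    · exact Set.Iic_subset_Iic.2 (le_max_right _ _)
  | smul a f _ hf =>
    rcases hf with rfl | ⟨v, hv, hf⟩
    · simp
    · exact Or.inr ⟨v, hv, Submodule.smul_mem _ _ hf⟩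

lemma coeff_eq_zero_of_mem_multiplesSpan {G : Set (MvPolynomial ι K)} {S : Set τ.syn}
    {f : MvPolynomial ι K} (hf : f ∈ multiplesSpan τ G S) {d : ι →₀ ℕ}
    (hd : ∀ w ∈ S, w < τ.toSyn d) : f.coeff d = 0 := by
  induction hf using Submodule.span_induction with
  | mem h hh =>
    obtain ⟨c, g, hg, hc, rfl⟩ := hh
    refine τ.coeff_eq_zero_of_lt (lt_of_le_of_lt (τ.degree_mul_le.trans ?_) (hd _ hc))
    rw [map_add, map_add]
    exact add_le_add_left (τ.degree_monomial_le _) _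
  | zero => simp
  | add f g _ _ hf hg => simp [hf, hg]
  | smul a f _ hf => simp [hf]

/-- A form of Buchberger's criterion: if any two monomial multiples of elements of `G` with the
same leading monomial differ by a combination of multiples with smaller leading monomials, then
the leading monomials of the ideal generated by `G` are those of the multiples of elements
of `G`. -/
theorem exists_degree_eq_of_mem_span {G : Set (MvPolynomial ι K)} (hmonic : ∀ g ∈ G, τ.Monic g)
    (hG : ∀ g ∈ G, ∀ h ∈ G, ∀ a b, a + τ.degree g = b + τ.degree h →
      monomial a 1 * g - monomial b 1 * h ∈
        multiplesSpan τ G (Set.Iio (τ.toSyn (a + τ.degree g))))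
    {f : MvPolynomial ι K} (hf : f ∈ Ideal.span G) (hf0 : f ≠ 0) :
    ∃ g ∈ G, ∃ a, τ.degree f = a + τ.degree g := by
  obtain ⟨w₀, -, hw₀⟩ := exists_mem_multiplesSpan_Iic (mem_multiplesSpan_univ G hf) hf0
  -- The least `w` such that `f` is a combination of multiples with leading exponent at most `w`.
  obtain ⟨w, hw, hmin⟩ := (wellFounded_lt (α := τ.syn)).has_min
    {w | f ∈ multiplesSpan τ G (Set.Iic w)} ⟨w₀, hw₀⟩
  have hlt : f ∉ multiplesSpan τ G (Set.Iio w) := fun h => by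
    obtain ⟨v, hv, hfv⟩ := exists_mem_multiplesSpan_Iic h hf0
    exact hmin v hfv hv
  by_cases hex : ∃ a, ∃ g ∈ G, τ.toSyn (a + τ.degree g) = w
  · obtain ⟨a, g, hg, rfl⟩ := hex
    refine ⟨g, hg, a, ?_⟩
    -- Modulo smaller multiples, all multiples with leading exponent `w` are equal.
    have hle : multiplesSpan τ G (Set.Iic (τ.toSyn (a + τ.degree g))) ≤
        Submodule.span K {monomial a 1 * g} ⊔
          multiplesSpan τ G (Set.Iio (τ.toSyn (a + τ.degree g))) := by
      refine Submodule.span_le.2 ?_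
      rintro _ ⟨b, h, hh, hb, rfl⟩
      rcases (show τ.toSyn (b + τ.degree h) ≤ _ from hb).eq_or_lt with hb | hb
      · have := hG g hg h hh a b (τ.toSyn.injective hb.symm)
        rw [← sub_sub_cancel (monomial a 1 * g) (monomial b 1 * h)]
        exact sub_mem (Submodule.mem_sup_left (Submodule.mem_span_singleton_self _))
          (Submodule.mem_sup_right this)
      · exact Submodule.mem_sup_right (Submodule.subset_span ⟨b, h, hh, hb, rfl⟩)
    obtain ⟨_, h₁, r, hr, hfr⟩ := Submodule.mem_sup.1 (hle hw)
    obtain ⟨k, rfl⟩ := Submodule.mem_span_singleton.1 h₁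
    have hk : k ≠ 0 := by
      rintro rfl
      rw [zero_smul, zero_add] at hfr
      exact hlt (hfr ▸ hr)
    have hcoeff : f.coeff (a + τ.degree g) ≠ 0 := by
      rw [← hfr, coeff_add, coeff_eq_zero_of_mem_multiplesSpan hr fun _ h => h, coeff_smul,
        coeff_monomial_mul, (hmonic g hg).coeff_degree]
      simpa using hk
    refine τ.toSyn.injective (le_antisymm ?_ (τ.le_degree (mem_support_iff.2 hcoeff)))
    by_contra! hcon
    exact τ.coeff_degree_ne_zero_iff.2 hf0
      (coeff_eq_zero_of_mem_multiplesSpan hw fun v hv => lt_of_le_of_lt hv hcon)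
  · refine absurd (Submodule.span_mono ?_ hw) hlt
    rintro _ ⟨b, h, hh, hb, rfl⟩
    exact ⟨b, h, hh, lt_of_le_of_ne hb fun hb => hex ⟨b, h, hh, hb⟩, rfl⟩

end Criterion

/-! ### Initial ideals -/

section Initial

variable {K ι : Type*} [Field K] (τ : MonomialOrder ι)

lemma leadingTerm_mem_initialIdeal {I : Ideal (MvPolynomial ι K)} {f : MvPolynomial ι K}
    (hf : f ∈ I) : τ.leadingTerm f ∈ initialIdeal τ I :=
  Ideal.subset_span ⟨f, hf, rfl⟩

lemma initialIdeal_mul_le (I J : Ideal (MvPolynomial ι K)) :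
    initialIdeal τ I * initialIdeal τ J ≤ initialIdeal τ (I * J) := by
  rw [initialIdeal, initialIdeal, Ideal.span_mul_span', Ideal.span_le]
  rintro _ ⟨_, ⟨f, hf, rfl⟩, _, ⟨g, hg, rfl⟩, rfl⟩
  change τ.leadingTerm f * τ.leadingTerm g ∈ _
  rw [← τ.leadingTerm_mul]
  exact leadingTerm_mem_initialIdeal τ (Ideal.mul_mem_mul hf hg)

end Initial

/-! ### Minors -/

section Minors

variable {R : Type*} [CommRing R] {n : ℕ} (X : Matrix (Fin 2) (Fin n) R)

lemma minor_eq (i j : Fin n) : minor X i j = X 0 i * X 1 j - X 0 j * X 1 i := by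
  simp [minor, Matrix.det_fin_two]

lemma minor_self (i : Fin n) : minor X i i = 0 := by
  rw [minor_eq, sub_self]

lemma minor_swap (i j : Fin n) : minor X j i = -minor X i j := by
  rw [minor_eq, minor_eq, neg_sub]

lemma minor_mem_minorsIdeal (i j : Fin n) : minor X i j ∈ minorsIdeal X := by
  rcases lt_trichotomy i j with h | rfl | h
  · exact Ideal.subset_span ⟨i, j, h, rfl⟩
  · rw [minor_self]
    exact zero_mem _
  · rw [minor_swap]
    exact neg_mem (Ideal.subset_span ⟨j, i, h, rfl⟩)

lemma minorsIdeal_submatrix_le (ρ : Equiv.Perm (Fin 2)) (π : Equiv.Perm (Fin n)) :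
    minorsIdeal (X.submatrix ρ π) ≤ minorsIdeal X := by
  refine Ideal.span_le.2 ?_
  rintro _ ⟨i, j, -, rfl⟩
  have : minor (X.submatrix ρ π) i j = (Equiv.Perm.sign ρ : ℤ) * minor X (π i) (π j) := by
    rw [minor, minor, ← Matrix.det_permute, Matrix.submatrix_submatrix, Matrix.submatrix_submatrix]
    congr 2
    ext k
    fin_cases k <;> rfl
  rw [this]
  exact Ideal.mul_mem_left _ _ (minor_mem_minorsIdeal X _ _)

lemma minorsIdeal_submatrix (ρ : Equiv.Perm (Fin 2)) (π : Equiv.Perm (Fin n)) :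
    minorsIdeal (X.submatrix ρ π) = minorsIdeal X := by
  refine le_antisymm (minorsIdeal_submatrix_le X ρ π) ?_
  simpa using minorsIdeal_submatrix_le (X.submatrix ρ π) ρ.symm π.symm

end Minors

lemma IsSparse.submatrix {K ι : Type*} [Field K] {n : ℕ}
    {X : Matrix (Fin 2) (Fin n) (MvPolynomial ι K)} (hX : IsSparse X)
    (ρ : Equiv.Perm (Fin 2)) (π : Equiv.Perm (Fin n)) : IsSparse (X.submatrix ρ π) where
  zero_or_var a j := hX.zero_or_var (ρ a) (π j)
  distinct a j b k h h' := by
    have := hX.distinct _ _ _ _ h h'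
    exact ⟨ρ.injective this.1, π.injective this.2⟩

/-! ### Leading monomials of the minors -/

section Straightening

variable {K ι : Type*} [Field K] {n : ℕ} {X : Matrix (Fin 2) (Fin n) (MvPolynomial ι K)}
  {τ : MonomialOrder ι}

/-- The nonzero `2 × 2` minors, with columns in increasing order. -/
def minors (X : Matrix (Fin 2) (Fin n) (MvPolynomial ι K)) : Set (MvPolynomial ι K) :=
  {f | ∃ i j : Fin n, i < j ∧ minor X i j ≠ 0 ∧ f = minor X i j}

lemma span_minors : Ideal.span (minors X) = minorsIdeal X := by
  refine le_antisymm (Ideal.span_mono ?_) (Ideal.span_le.2 ?_)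
  · rintro _ ⟨i, j, h, -, rfl⟩
    exact ⟨i, j, h, rfl⟩
  · rintro _ ⟨i, j, h, rfl⟩
    by_cases h0 : minor X i j = 0
    · rw [h0]
      exact zero_mem _
    · exact Ideal.subset_span ⟨i, j, h, h0, rfl⟩

lemma IsSparse.degree_apply_eq_zero_or (hX : IsSparse X) {a b : Fin 2} {j k : Fin n}
    (h : (a, j) ≠ (b, k)) (t : ι) : τ.degree (X a j) t = 0 ∨ τ.degree (X b k) t = 0 := by
  classical
  rcases hX.zero_or_var a j with h₁ | ⟨u, h₁⟩
  · simp [h₁]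
  rcases hX.zero_or_var b k with h₂ | ⟨v, h₂⟩
  · simp [h₂]
  have huv : u ≠ v := by
    rintro rfl
    have := hX.distinct a j b k (by simp [h₁]) (h₁.trans h₂.symm)
    exact h (by rw [this.1, this.2])
  rw [h₁, h₂, τ.degree_X, τ.degree_X]
  by_cases hu : u = t
  · subst hu
    simp [huv.symm]
  · simp [hu]

lemma IsSparse.eq_monomial (hX : IsSparse X) {a : Fin 2} {j : Fin n} (h : X a j ≠ 0) :
    X a j = monomial (τ.degree (X a j)) 1 := by
  obtain ⟨v, hv⟩ := (hX.zero_or_var a j).resolve_left h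
  rw [hv, τ.degree_X]
  rfl

/-- If `x ^ a` times one monomial equals `x ^ b` times another one coprime to it, then each of
`x ^ a` and `x ^ b` is a multiple of the other factor. -/
lemma exists_add_of_add_eq_add {a b d e : ι →₀ ℕ} (h : a + d = b + e)
    (hde : ∀ t, d t = 0 ∨ e t = 0) : ∃ c, a = c + e ∧ b = c + d := by
  have h' : ∀ t, a t + d t = b t + e t := fun t => DFunLike.congr_fun h t
  refine ⟨a - e, ?_, ?_⟩ <;> ext t <;> have := h' t <;> have := hde t <;>
    simp only [Finsupp.add_apply, Finsupp.tsub_apply] <;> omega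

lemma degree_monomial_mul (c : ι →₀ ℕ) {f : MvPolynomial ι K} (hf : f ≠ 0) :
    τ.degree (monomial c 1 * f) = c + τ.degree f := by
  classical
  rw [τ.degree_mul (by simp) hf, τ.degree_monomial, if_neg one_ne_zero]

lemma toSyn_lt_of_eq_add {x y s t d : ι →₀ ℕ} (h : x ≺[τ] y) (hs : s = x + d) (ht : t = y + d) :
    s ≺[τ] t := by
  rw [hs, ht, map_add, map_add]
  exact add_lt_add_left h _

lemma IsDiagonalOrder.entries_ne_zero (hτ : IsDiagonalOrder τ X) {i j : Fin n} (hij : i < j)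
    (h : minor X i j ≠ 0) : X 0 i ≠ 0 ∧ X 1 j ≠ 0 := by
  rw [← mul_ne_zero_iff, ← hτ i j hij]
  exact fun h' => h ((τ.leadingTerm_eq_zero_iff _).1 h')

lemma IsDiagonalOrder.degree_minor (hτ : IsDiagonalOrder τ X) {i j : Fin n} (hij : i < j)
    (h : minor X i j ≠ 0) : τ.degree (minor X i j) = τ.degree (X 0 i) + τ.degree (X 1 j) := by
  obtain ⟨hi, hj⟩ := hτ.entries_ne_zero hij h
  rw [← τ.degree_leadingTerm, hτ i j hij, τ.degree_mul hi hj]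

lemma IsDiagonalOrder.monic_minor (hτ : IsDiagonalOrder τ X) (hX : IsSparse X) {i j : Fin n}
    (hij : i < j) (h : minor X i j ≠ 0) : τ.Monic (minor X i j) := by
  obtain ⟨hi, hj⟩ := hτ.entries_ne_zero hij h
  rw [MonomialOrder.Monic, ← τ.leadingCoeff_leadingTerm, hτ i j hij, hX.eq_monomial (τ := τ) hi,
    hX.eq_monomial (τ := τ) hj]
  exact MonomialOrder.Monic.mul τ.monic_monomial_one τ.monic_monomial_one

/-- Zeros of the matrix are arranged so that a nonzero antidiagonal product forces a nonzero,
larger diagonal product. -/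
lemma IsDiagonalOrder.antidiagonal_lt (hτ : IsDiagonalOrder τ X) (hX : IsSparse X) {i j : Fin n}
    (hij : i < j) (hj : X 0 j ≠ 0) (hi : X 1 i ≠ 0) :
    τ.degree (X 0 j) + τ.degree (X 1 i) ≺[τ] τ.degree (X 0 i) + τ.degree (X 1 j) := by
  classical
  have hne : τ.degree (X 0 i) + τ.degree (X 1 j) ≠ τ.degree (X 0 j) + τ.degree (X 1 i) := by
    intro h
    obtain ⟨v, hv⟩ := (hX.zero_or_var 0 j).resolve_left hj
    have h₁ := DFunLike.congr_fun h v
    have hv1 : τ.degree (X 0 j) v = 1 := by rw [hv, τ.degree_X, Finsupp.single_eq_same]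
    have h₂ := hX.degree_apply_eq_zero_or (τ := τ) (a := 0) (b := 0) (j := i) (k := j)
      (by simp [hij.ne]) v
    have h₃ := hX.degree_apply_eq_zero_or (τ := τ) (a := 1) (b := 0) (j := j) (k := j)
      (by simp) v
    simp only [Finsupp.add_apply] at h₁
    omega
  have hcoeff : (minor X i j).coeff (τ.degree (X 0 j) + τ.degree (X 1 i)) ≠ 0 := by
    have h₁ : X 0 j * X 1 i = monomial (τ.degree (X 0 j) + τ.degree (X 1 i)) 1 := by
      conv_lhs => rw [hX.eq_monomial (τ := τ) hj, hX.eq_monomial (τ := τ) hi]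
      rw [monomial_mul, one_mul]
    rw [minor_eq, h₁, coeff_sub, coeff_monomial, if_pos rfl]
    suffices (X 0 i * X 1 j).coeff (τ.degree (X 0 j) + τ.degree (X 1 i)) = 0 by simp [this]
    by_cases h0 : X 0 i * X 1 j = 0
    · simp [h0]
    · obtain ⟨hi', hj'⟩ := mul_ne_zero_iff.1 h0
      rw [hX.eq_monomial (τ := τ) hi', hX.eq_monomial (τ := τ) hj', monomial_mul, coeff_monomial,
        if_neg hne]
  have h0 : minor X i j ≠ 0 := by
    intro h
    simp [h] at hcoeff
  have := τ.le_degree (mem_support_iff.2 hcoeff)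
  rw [hτ.degree_minor hij h0] at this
  exact lt_of_le_of_ne this fun h => hne (τ.toSyn.injective h).symm

lemma mem_minors_or_neg_mem {i j : Fin n} (h : minor X i j ≠ 0) :
    minor X i j ∈ minors X ∨ -minor X i j ∈ minors X := by
  rcases lt_trichotomy i j with hij | rfl | hij
  · exact Or.inl ⟨i, j, hij, h, rfl⟩
  · exact absurd (minor_self X i) h
  · rw [← minor_swap]
    rw [minor_swap, neg_ne_zero] at h
    exact Or.inr ⟨j, i, hij, h, rfl⟩

lemma mul_minor_mem {i j : Fin n} {p : MvPolynomial ι K} {w : ι →₀ ℕ}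
    (h : p ≠ 0 → minor X i j ≠ 0 → τ.degree p + τ.degree (minor X i j) ≺[τ] w) :
    p * minor X i j ∈ multiplesSpan τ (minors X) (Set.Iio (τ.toSyn w)) := by
  by_cases h0 : minor X i j = 0
  · rw [h0, mul_zero]
    exact zero_mem _
  rcases mem_minors_or_neg_mem h0 with hm | hm
  · exact mul_mem_multiplesSpan_Iio hm fun hp => h hp h0
  · rw [← neg_mem_iff, ← mul_neg]
    exact mul_mem_multiplesSpan_Iio hm fun hp => by simpa using h hp h0

lemma mul_minor_mul_minor_mem {i j k l : Fin n} {p : MvPolynomial ι K} {w : ι →₀ ℕ}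
    (h : p ≠ 0 → minor X i j ≠ 0 → minor X k l ≠ 0 →
      τ.degree p + (τ.degree (minor X i j) + τ.degree (minor X k l)) ≺[τ] w) :
    p * (minor X i j * minor X k l) ∈
      multiplesSpan τ (minors X * minors X) (Set.Iio (τ.toSyn w)) := by
  by_cases h0 : minor X i j = 0
  · rw [h0, zero_mul, mul_zero]
    exact zero_mem _
  by_cases h1 : minor X k l = 0
  · rw [h1, mul_zero, mul_zero]
    exact zero_mem _
  have h2 : p ≠ 0 → τ.degree p + τ.degree (minor X i j * minor X k l) ≺[τ] w := fun hp => by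
    rw [τ.degree_mul h0 h1]
    exact h hp h0 h1
  suffices hm : minor X i j * minor X k l ∈ minors X * minors X ∨
      -(minor X i j * minor X k l) ∈ minors X * minors X by
    rcases hm with hm | hm
    · exact mul_mem_multiplesSpan_Iio hm h2
    · rw [← neg_mem_iff, ← mul_neg]
      exact mul_mem_multiplesSpan_Iio hm fun hp => by simpa using h2 hp
  rcases mem_minors_or_neg_mem h0 with hi | hi <;> rcases mem_minors_or_neg_mem h1 with hk | hk
  · exact Or.inl (Set.mul_mem_mul hi hk)
  · exact Or.inr (by simpa using Set.mul_mem_mul hi hk)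
  · exact Or.inr (by simpa using Set.mul_mem_mul hi hk)
  · exact Or.inl (by simpa using Set.mul_mem_mul hi hk)

/-- Multiplying by a fixed element of `H` carries combinations of multiples of elements of `G` to
combinations of multiples of products, shifting the bound on exponents by its degree. -/
lemma mul_mem_multiplesSpan_mul {G H : Set (MvPolynomial ι K)} (hG : ∀ g ∈ G, g ≠ 0)
    {w : ι →₀ ℕ} {f h : MvPolynomial ι K}
    (hf : f ∈ multiplesSpan τ G (Set.Iio (τ.toSyn w))) (hh : h ∈ H) (h0 : h ≠ 0) :
    f * h ∈ multiplesSpan τ (G * H) (Set.Iio (τ.toSyn (w + τ.degree h))) := by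
  induction hf using Submodule.span_induction with
  | mem f hf =>
    obtain ⟨c, g, hg, hc, rfl⟩ := hf
    refine Submodule.subset_span ⟨c, g * h, Set.mul_mem_mul hg hh, ?_, mul_assoc _ _ _⟩
    rw [τ.degree_mul (hG g hg) h0]
    exact toSyn_lt_of_eq_add hc (add_assoc _ _ _).symm rfl
  | zero =>
    rw [zero_mul]
    exact zero_mem _
  | add f g _ _ hf hg =>
    rw [add_mul]
    exact add_mem hf hg
  | smul a f _ hf =>
    rw [smul_mul_assoc]
    exact Submodule.smul_mem _ _ hf

/-! ### Straightening relations -/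

/-- Two multiples of minors with the same leading monomial are congruent modulo multiples of
minors with smaller leading monomials. -/
lemma IsDiagonalOrder.sub_mem_of_minors (hτ : IsDiagonalOrder τ X) (hX : IsSparse X)
    {i j k l : Fin n} (hij : i < j) (hkl : k < l) (h₁ : minor X i j ≠ 0) (h₂ : minor X k l ≠ 0)
    {a b : ι →₀ ℕ}
    (hab : a + τ.degree (minor X i j) = b + τ.degree (minor X k l)) :
    monomial a 1 * minor X i j - monomial b 1 * minor X k l ∈
      multiplesSpan τ (minors X) (Set.Iio (τ.toSyn (a + τ.degree (minor X i j)))) := by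
  obtain ⟨hi, hj⟩ := hτ.entries_ne_zero hij h₁
  obtain ⟨hk, hl⟩ := hτ.entries_ne_zero hkl h₂
  rw [hτ.degree_minor hij h₁, hτ.degree_minor hkl h₂] at hab
  rw [hτ.degree_minor hij h₁]
  have mono_add : ∀ c d : ι →₀ ℕ, (monomial (c + d) (1 : K)) = monomial c 1 * monomial d 1 := by
    intro c d
    rw [monomial_mul, one_mul]
  have e₁ := hX.eq_monomial (τ := τ) hi
  have e₂ := hX.eq_monomial (τ := τ) hj
  have e₃ := hX.eq_monomial (τ := τ) hk
  have e₄ := hX.eq_monomial (τ := τ) hl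
  by_cases hik : i = k
  · subst hik
    by_cases hjl : j = l
    · subst hjl
      rw [add_right_cancel hab, sub_self]
      exact zero_mem _
    -- Common first column: the difference is a multiple of the minor on the columns `j` and `l`.
    obtain ⟨c, rfl, rfl⟩ := exists_add_of_add_eq_add (a := a) (b := b) (d := τ.degree (X 1 j))
      (e := τ.degree (X 1 l)) (add_right_cancel (b := τ.degree (X 0 i)) (by
        rw [add_assoc, add_comm (τ.degree (X 1 j)), hab, add_assoc, add_comm (τ.degree (X 0 i))]))
      (hX.degree_apply_eq_zero_or (by simpa using hjl))
    have : monomial (c + τ.degree (X 1 l)) 1 * minor X i j -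
        monomial (c + τ.degree (X 1 j)) 1 * minor X i l =
          -((monomial c 1 * X 1 i) * minor X j l) := by
      rw [mono_add, mono_add, ← e₂, ← e₄, minor_eq, minor_eq, minor_eq]
      ring
    rw [this]
    refine neg_mem (mul_minor_mem fun hp h0 => ?_)
    have hi1 : X 1 i ≠ 0 := right_ne_zero_of_mul hp
    rw [degree_monomial_mul c hi1]
    rcases lt_or_gt_of_ne hjl with hlt | hlt
    · rw [hτ.degree_minor hlt h0]
      exact toSyn_lt_of_eq_add (d := c + τ.degree (X 1 l))
        (hτ.antidiagonal_lt hX hij (hτ.entries_ne_zero hlt h0).1 hi1) (by abel) (by abel)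
    · rw [minor_swap, neg_ne_zero] at h0
      rw [minor_swap, τ.degree_neg, hτ.degree_minor hlt h0]
      exact toSyn_lt_of_eq_add (d := c + τ.degree (X 1 j))
        (hτ.antidiagonal_lt hX hkl (hτ.entries_ne_zero hlt h0).1 hi1) (by abel) (by abel)
  by_cases hjl : j = l
  · subst hjl
    -- Common second column: the difference is a multiple of the minor on the columns `i` and `k`.
    obtain ⟨c, rfl, rfl⟩ := exists_add_of_add_eq_add (a := a) (b := b) (d := τ.degree (X 0 i))
      (e := τ.degree (X 0 k)) (add_right_cancel (b := τ.degree (X 1 j)) (by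
        rw [add_assoc, hab, add_assoc]))
      (hX.degree_apply_eq_zero_or (by simpa using hik))
    have : monomial (c + τ.degree (X 0 k)) 1 * minor X i j -
        monomial (c + τ.degree (X 0 i)) 1 * minor X k j =
          (monomial c 1 * X 0 j) * minor X i k := by
      rw [mono_add, mono_add, ← e₁, ← e₃, minor_eq, minor_eq, minor_eq]
      ring
    rw [this]
    refine mul_minor_mem fun hp h0 => ?_
    have hj0 : X 0 j ≠ 0 := right_ne_zero_of_mul hp
    rw [degree_monomial_mul c hj0]
    rcases lt_or_gt_of_ne hik with hlt | hlt
    · rw [hτ.degree_minor hlt h0]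
      exact toSyn_lt_of_eq_add (d := c + τ.degree (X 0 i))
        (hτ.antidiagonal_lt hX hkl hj0 (hτ.entries_ne_zero hlt h0).2) (by abel) (by abel)
    · rw [minor_swap, neg_ne_zero] at h0
      rw [minor_swap, τ.degree_neg, hτ.degree_minor hlt h0]
      exact toSyn_lt_of_eq_add (d := c + τ.degree (X 0 k))
        (hτ.antidiagonal_lt hX hij hj0 (hτ.entries_ne_zero hlt h0).2) (by abel) (by abel)
  -- Coprime leading monomials: after subtracting the product of the two minors from both
  -- multiples, only the antidiagonal terms remain as coefficients.
  obtain ⟨c, rfl, rfl⟩ := exists_add_of_add_eq_add hab fun t => by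
    have h₁ := hX.degree_apply_eq_zero_or (τ := τ) (a := 0) (b := 0) (j := i) (k := k)
      (by simpa using hik) t
    have h₂ := hX.degree_apply_eq_zero_or (τ := τ) (a := 1) (b := 1) (j := j) (k := l)
      (by simpa using hjl) t
    have h₃ := hX.degree_apply_eq_zero_or (τ := τ) (a := 0) (b := 1) (j := i) (k := l) (by simp) t
    have h₄ := hX.degree_apply_eq_zero_or (τ := τ) (a := 1) (b := 0) (j := j) (k := k) (by simp) t
    have h₅ := hX.degree_apply_eq_zero_or (τ := τ) (a := 0) (b := 1) (j := i) (k := j) (by simp) t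
    simp only [Finsupp.add_apply]
    omega
  have : monomial (c + (τ.degree (X 0 k) + τ.degree (X 1 l))) 1 * minor X i j -
      monomial (c + (τ.degree (X 0 i) + τ.degree (X 1 j))) 1 * minor X k l =
        (monomial c 1 * (X 0 l * X 1 k)) * minor X i j -
          (monomial c 1 * (X 0 j * X 1 i)) * minor X k l := by
    rw [mono_add, mono_add, mono_add, mono_add, ← e₁, ← e₂, ← e₃, ← e₄, minor_eq, minor_eq]
    ring
  rw [this]
  refine sub_mem (mul_minor_mem fun hp h0 => ?_) (mul_minor_mem fun hp h0 => ?_)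
  · have hp' := right_ne_zero_of_mul hp
    obtain ⟨hl0, hk1⟩ := mul_ne_zero_iff.1 hp'
    rw [degree_monomial_mul c hp', τ.degree_mul hl0 hk1, hτ.degree_minor hij h0]
    exact toSyn_lt_of_eq_add (d := c + (τ.degree (X 0 i) + τ.degree (X 1 j)))
      (hτ.antidiagonal_lt hX hkl hl0 hk1) (by abel) (by abel)
  · have hp' := right_ne_zero_of_mul hp
    obtain ⟨hj0, hi1⟩ := mul_ne_zero_iff.1 hp'
    rw [degree_monomial_mul c hp', τ.degree_mul hj0 hi1, hτ.degree_minor hkl h0]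
    exact toSyn_lt_of_eq_add (d := c + (τ.degree (X 0 k) + τ.degree (X 1 l)))
      (hτ.antidiagonal_lt hX hij hj0 hi1) (by abel) (by abel)

lemma ne_zero_of_mem_minors {g : MvPolynomial ι K} (hg : g ∈ minors X) : g ≠ 0 := by
  obtain ⟨i, j, -, h, rfl⟩ := hg
  exact h

/-- Two multiples of products of two minors with the same leading monomial and a common factor
are congruent modulo multiples with smaller leading monomials. -/
lemma IsDiagonalOrder.sub_mem_of_common_factor (hτ : IsDiagonalOrder τ X) (hX : IsSparse X)
    {f g h : MvPolynomial ι K} (hf : f ∈ minors X) (hg : g ∈ minors X) (hh : h ∈ minors X)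
    {a b w : ι →₀ ℕ} (ha : w = a + (τ.degree f + τ.degree h))
    (hb : w = b + (τ.degree g + τ.degree h)) :
    monomial a 1 * (f * h) - monomial b 1 * (g * h) ∈
      multiplesSpan τ (minors X * minors X) (Set.Iio (τ.toSyn w)) := by
  obtain ⟨i, j, hij, hf0, rfl⟩ := hf
  obtain ⟨k, l, hkl, hg0, rfl⟩ := hg
  have hab : a + τ.degree (minor X i j) = b + τ.degree (minor X k l) := by
    refine add_right_cancel (b := τ.degree h) ?_
    rw [add_assoc, add_assoc, ← ha, ← hb]
  have := mul_mem_multiplesSpan_mul (fun _ => ne_zero_of_mem_minors)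
    (hτ.sub_mem_of_minors hX hij hkl hf0 hg0 hab) hh (ne_zero_of_mem_minors hh)
  rw [add_assoc, ← ha] at this
  rwa [← mul_assoc, ← mul_assoc, ← sub_mul]

/-- The case of two pairings of the same four entries, a consequence of the Plücker relation. -/
lemma IsDiagonalOrder.sub_mem_of_crossing (hτ : IsDiagonalOrder τ X) (hX : IsSparse X)
    {i j k l : Fin n} (hij : i < j) (hkl : k < l) (hil : i < l) (hkj : k < j) (hik : i ≠ k)
    (hjl : j ≠ l) (h₁ : minor X i j ≠ 0) (h₂ : minor X k l ≠ 0) (a : ι →₀ ℕ) :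
    monomial a 1 * (minor X i j * minor X k l) - monomial a 1 * (minor X i l * minor X k j) ∈
      multiplesSpan τ (minors X * minors X)
        (Set.Iio (τ.toSyn (a + (τ.degree (minor X i j) + τ.degree (minor X k l))))) := by
  classical
  have : monomial a 1 * (minor X i j * minor X k l) - monomial a 1 * (minor X i l * minor X k j) =
      monomial a 1 * (minor X i k * minor X j l) := by
    simp only [minor_eq]
    ring
  rw [this]
  refine mul_minor_mul_minor_mem fun _ hik0 hjl0 => ?_
  rw [hτ.degree_minor hij h₁, hτ.degree_minor hkl h₂, τ.degree_monomial, if_neg one_ne_zero]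
  rcases lt_or_gt_of_ne hik with hik | hik <;> rcases lt_or_gt_of_ne hjl with hjl | hjl
  · rw [hτ.degree_minor hik hik0, hτ.degree_minor hjl hjl0]
    exact toSyn_lt_of_eq_add (d := a + (τ.degree (X 0 i) + τ.degree (X 1 l)))
      (hτ.antidiagonal_lt hX hkj (hτ.entries_ne_zero hjl hjl0).1
        (hτ.entries_ne_zero hik hik0).2) (by abel) (by abel)
  · rw [minor_swap, neg_ne_zero] at hjl0
    rw [minor_swap X l j, τ.degree_neg, hτ.degree_minor hik hik0, hτ.degree_minor hjl hjl0]
    exact toSyn_lt_of_eq_add (d := a + (τ.degree (X 0 i) + τ.degree (X 1 j)))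
      (hτ.antidiagonal_lt hX hkl (hτ.entries_ne_zero hjl hjl0).1
        (hτ.entries_ne_zero hik hik0).2) (by abel) (by abel)
  · rw [minor_swap, neg_ne_zero] at hik0
    rw [minor_swap X k i, τ.degree_neg, hτ.degree_minor hik hik0, hτ.degree_minor hjl hjl0]
    exact toSyn_lt_of_eq_add (d := a + (τ.degree (X 0 k) + τ.degree (X 1 l)))
      (hτ.antidiagonal_lt hX hij (hτ.entries_ne_zero hjl hjl0).1
        (hτ.entries_ne_zero hik hik0).2) (by abel) (by abel)
  · rw [minor_swap, neg_ne_zero] at hik0 hjl0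
    rw [minor_swap X k i, minor_swap X l j, τ.degree_neg, τ.degree_neg,
      hτ.degree_minor hik hik0, hτ.degree_minor hjl hjl0]
    exact toSyn_lt_of_eq_add (d := a + (τ.degree (X 0 k) + τ.degree (X 1 j)))
      (hτ.antidiagonal_lt hX hil (hτ.entries_ne_zero hjl hjl0).1
        (hτ.entries_ne_zero hik hik0).2) (by abel) (by abel)

/-- If both `x_i y_j x_k y_l` and `x_p y_q x_r y_s` divide the monomial `x ^ w`, then so does
`x_p y_q x_k y_l`, unless an entry needed twice occurs only once in each of the two products. -/
lemma IsSparse.degree_add_degree_le (hX : IsSparse X) {i j k l p q r s : Fin n}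
    {a b w : ι →₀ ℕ}
    (ha : w = a + (τ.degree (X 0 i) + τ.degree (X 1 j) + (τ.degree (X 0 k) + τ.degree (X 1 l))))
    (hb : w = b + (τ.degree (X 0 p) + τ.degree (X 1 q) + (τ.degree (X 0 r) + τ.degree (X 1 s))))
    (hp : p = k → i = k ∨ r = p) (hq : q = l → j = l ∨ s = q) :
    τ.degree (X 0 p) + τ.degree (X 1 q) + (τ.degree (X 0 k) + τ.degree (X 1 l)) ≤ w := by
  intro t
  have ha := DFunLike.congr_fun ha t
  have hb := DFunLike.congr_fun hb t
  simp only [Finsupp.add_apply] at ha hb ⊢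
  have h₀ : τ.degree (X 0 p) t + τ.degree (X 0 k) t ≤ w t := by
    by_cases hpk : p = k
    · rcases hp hpk with h | h
      · subst hpk h
        omega
      · subst hpk h
        omega
    · have := hX.degree_apply_eq_zero_or (τ := τ) (a := 0) (b := 0) (j := p) (k := k)
        (by simpa using hpk) t
      omega
  have h₁ : τ.degree (X 1 q) t + τ.degree (X 1 l) t ≤ w t := by
    by_cases hql : q = l
    · rcases hq hql with h | h
      · subst hql h
        omega
      · subst hql h
        omega
    · have := hX.degree_apply_eq_zero_or (τ := τ) (a := 1) (b := 1) (j := q) (k := l)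
        (by simpa using hql) t
      omega
  -- The entries of the first row and those of the second row involve different variables.
  have hc := fun x y => hX.degree_apply_eq_zero_or (τ := τ) (a := 0) (b := 1) (j := x) (k := y)
    (by simp) t
  have := hc p q
  have := hc p l
  have := hc k q
  have := hc k l
  omega

/-- If a minor `p` can replace `f` in the multiple of `f * g`, then any two multiples of `f * g`
and `p * q` with the same leading monomial are congruent, by way of a multiple of `p * g`. -/
lemma IsDiagonalOrder.sub_mem_of_le (hτ : IsDiagonalOrder τ X) (hX : IsSparse X)
    {f g p q : MvPolynomial ι K} (hf : f ∈ minors X) (hg : g ∈ minors X) (hp : p ∈ minors X)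
    (hq : q ∈ minors X) {a b w : ι →₀ ℕ} (ha : w = a + (τ.degree f + τ.degree g))
    (hb : w = b + (τ.degree p + τ.degree q)) (hle : τ.degree p + τ.degree g ≤ w) :
    monomial a 1 * (f * g) - monomial b 1 * (p * q) ∈
      multiplesSpan τ (minors X * minors X) (Set.Iio (τ.toSyn w)) := by
  obtain ⟨c, hc⟩ := exists_add_of_le hle
  rw [add_comm] at hc
  rw [← sub_add_sub_cancel _ (monomial c 1 * (p * g))]
  refine add_mem (hτ.sub_mem_of_common_factor hX hf hp hg ha hc) ?_
  rw [mul_comm p g, mul_comm p q]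
  exact hτ.sub_mem_of_common_factor hX hg hq hp (by rw [hc, add_comm (τ.degree p)])
    (by rw [hb, add_comm (τ.degree p)])

/-- Two multiples of products of two minors with the same leading monomial are congruent modulo
multiples with smaller leading monomials. Either one factor can be exchanged, or the two products
come from different pairings of the same four entries. -/
theorem IsDiagonalOrder.sub_mem_of_mul_minors (hτ : IsDiagonalOrder τ X) (hX : IsSparse X)
    {g h : MvPolynomial ι K} (hg : g ∈ minors X * minors X) (hh : h ∈ minors X * minors X)
    {a b : ι →₀ ℕ} (hab : a + τ.degree g = b + τ.degree h) :
    monomial a 1 * g - monomial b 1 * h ∈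
      multiplesSpan τ (minors X * minors X) (Set.Iio (τ.toSyn (a + τ.degree g))) := by
  obtain ⟨e₁, he₁, e₂, he₂, rfl⟩ := hg
  obtain ⟨e₃, he₃, e₄, he₄, rfl⟩ := hh
  dsimp only at hab ⊢
  rw [τ.degree_mul (ne_zero_of_mem_minors he₁) (ne_zero_of_mem_minors he₂)] at hab ⊢
  rw [τ.degree_mul (ne_zero_of_mem_minors he₃) (ne_zero_of_mem_minors he₄)] at hab
  obtain ⟨w, hw⟩ : ∃ w, w = a + (τ.degree e₁ + τ.degree e₂) := ⟨_, rfl⟩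
  have hw' := hw.trans hab
  rw [← hw]
  have hwa : w = a + (τ.degree e₂ + τ.degree e₁) := by rw [hw, add_comm (τ.degree e₂)]
  have hwb : w = b + (τ.degree e₄ + τ.degree e₃) := by rw [hw', add_comm (τ.degree e₄)]
  by_cases h32 : τ.degree e₃ + τ.degree e₂ ≤ w
  · exact hτ.sub_mem_of_le hX he₁ he₂ he₃ he₄ hw hw' h32
  by_cases h31 : τ.degree e₃ + τ.degree e₁ ≤ w
  · rw [mul_comm e₁ e₂]
    exact hτ.sub_mem_of_le hX he₂ he₁ he₃ he₄ hwa hw' h31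
  by_cases h42 : τ.degree e₄ + τ.degree e₂ ≤ w
  · rw [mul_comm e₃ e₄]
    exact hτ.sub_mem_of_le hX he₁ he₂ he₄ he₃ hw hwb h42
  by_cases h41 : τ.degree e₄ + τ.degree e₁ ≤ w
  · rw [mul_comm e₁ e₂, mul_comm e₃ e₄]
    exact hτ.sub_mem_of_le hX he₂ he₁ he₄ he₃ hwa hwb h41
  obtain ⟨i, j, hij, h₁, rfl⟩ := he₁
  obtain ⟨k, l, hkl, h₂, rfl⟩ := he₂
  obtain ⟨p, q, hpq, h₃, rfl⟩ := he₃
  obtain ⟨r, s, hrs, h₄, rfl⟩ := he₄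
  have hW : w = a + (τ.degree (X 0 i) + τ.degree (X 1 j) +
      (τ.degree (X 0 k) + τ.degree (X 1 l))) := by
    rw [hw, hτ.degree_minor hij h₁, hτ.degree_minor hkl h₂]
  have hW' : w = b + (τ.degree (X 0 p) + τ.degree (X 1 q) +
      (τ.degree (X 0 r) + τ.degree (X 1 s))) := by
    rw [hw', hτ.degree_minor hpq h₃, hτ.degree_minor hrs h₄]
  rw [hτ.degree_minor hpq h₃, hτ.degree_minor hkl h₂] at h32
  rw [hτ.degree_minor hpq h₃, hτ.degree_minor hij h₁] at h31
  rw [hτ.degree_minor hrs h₄, hτ.degree_minor hkl h₂] at h42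
  rw [hτ.degree_minor hrs h₄, hτ.degree_minor hij h₁] at h41
  obtain ⟨hik, hjl, hcases⟩ : i ≠ k ∧ j ≠ l ∧
      (p = k ∧ q = j ∧ r = i ∧ s = l ∨ p = i ∧ q = l ∧ r = k ∧ s = j) := by
    have hWa : w = a + (τ.degree (X 0 k) + τ.degree (X 1 l) +
        (τ.degree (X 0 i) + τ.degree (X 1 j))) := by
      rw [hW, add_comm (τ.degree (X 0 i) + _)]
    have hWb : w = b + (τ.degree (X 0 r) + τ.degree (X 1 s) +
        (τ.degree (X 0 p) + τ.degree (X 1 q))) := by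
      rw [hW', add_comm (τ.degree (X 0 p) + _)]
    have n₁ := fun h h' => h32 (hX.degree_add_degree_le hW hW' h h')
    have n₂ := fun h h' => h31 (hX.degree_add_degree_le hWa hW' h h')
    have n₃ := fun h h' => h42 (hX.degree_add_degree_le hW hWb h h')
    have n₄ := fun h h' => h41 (hX.degree_add_degree_le hWa hWb h h')
    clear * - n₁ n₂ n₃ n₄
    grind
  have hb : b = a := by
    refine add_right_cancel (hW'.symm.trans (hW.trans ?_))
    rcases hcases with ⟨rfl, rfl, rfl, rfl⟩ | ⟨rfl, rfl, rfl, rfl⟩ <;> abel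
  subst hb
  rw [hw]
  rcases hcases with ⟨rfl, rfl, rfl, rfl⟩ | ⟨rfl, rfl, rfl, rfl⟩
  · rw [mul_comm (minor X p q)]
    exact hτ.sub_mem_of_crossing hX hij hkl hrs hpq hik hjl h₁ h₂ b
  · exact hτ.sub_mem_of_crossing hX hij hkl hpq hrs hik hjl h₁ h₂ b

/-! ### The initial ideal of the square -/

lemma IsDiagonalOrder.initialIdeal_sq (hτ : IsDiagonalOrder τ X) (hX : IsSparse X) :
    initialIdeal τ (minorsIdeal X ^ 2) = initialIdeal τ (minorsIdeal X) ^ 2 := by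
  rw [sq, sq]
  refine le_antisymm (Ideal.span_le.2 ?_) (initialIdeal_mul_le τ _ _)
  rintro _ ⟨f, hf, rfl⟩
  by_cases hf0 : f = 0
  · rw [hf0, τ.leadingTerm_zero]
    exact zero_mem _
  rw [SetLike.mem_coe, ← span_minors, Ideal.span_mul_span'] at hf
  obtain ⟨_, ⟨g, hg, h, hh, rfl⟩, a, ha⟩ := exists_degree_eq_of_mem_span (τ := τ) (by
      rintro _ ⟨_, ⟨i, j, hij, h₁, rfl⟩, _, ⟨k, l, hkl, h₂, rfl⟩, rfl⟩
      exact (hτ.monic_minor hX hij h₁).mul (hτ.monic_minor hX hkl h₂))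
    (fun g hg h hh a b hab => hτ.sub_mem_of_mul_minors hX hg hh hab) hf hf0
  have hmonic : ∀ g ∈ minors X, τ.leadingTerm g = monomial (τ.degree g) 1 := by
    rintro _ ⟨i, j, hij, h₁, rfl⟩
    rw [MonomialOrder.leadingTerm, (hτ.monic_minor hX hij h₁).leadingCoeff_eq_one]
  have hmem : ∀ g ∈ minors X, τ.leadingTerm g ∈ initialIdeal τ (minorsIdeal X) := by
    rintro _ ⟨i, j, -, -, rfl⟩
    exact leadingTerm_mem_initialIdeal τ (minor_mem_minorsIdeal X i j)
  have : τ.leadingTerm f =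
      monomial a (τ.leadingCoeff f) * (τ.leadingTerm g * τ.leadingTerm h) := by
    rw [hmonic g hg, hmonic h hh, monomial_mul, monomial_mul, mul_one, mul_one,
      ← τ.degree_mul (ne_zero_of_mem_minors hg) (ne_zero_of_mem_minors hh), ← ha]
    rfl
  rw [this]
  exact Ideal.mul_mem_left _ _ (Ideal.mul_mem_mul (hmem g hg) (hmem h hh))

end Straightening

end

end SparseDet

/-- `K[x_v : v ∈ ι]` is the polynomial ring in exactly the variables that appear in the sparse
matrix `X`, and `τ` is diagonal for `X` after a permutation of its rows and columns
(the identity permutations give the matrix `X` itself). -/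
theorem mainTheorem10 {K ι : Type*} [Field K] (n : ℕ)
    (X : Matrix (Fin 2) (Fin n) (MvPolynomial ι K)) (hX : SparseDet.IsSparse X)
    (hvars : ∀ v : ι, ∃ a j, X a j = MvPolynomial.X v)
    (τ : MonomialOrder ι) (ρ : Equiv.Perm (Fin 2)) (π : Equiv.Perm (Fin n))
    (hτ : SparseDet.IsDiagonalOrder τ (X.submatrix ρ π)) :
    SparseDet.initialIdeal τ (SparseDet.minorsIdeal X ^ 2) =
      SparseDet.initialIdeal τ (SparseDet.minorsIdeal X) ^ 2 := by
  rw [← SparseDet.minorsIdeal_submatrix X ρ π]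
  exact hτ.initialIdeal_sq (hX.submatrix ρ π)
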